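/- Fix an integer $B\ge 2$. Given an odd number $n$ of real data points $x_1,\dots,x_n$ with mean $\hat\mu=\frac1n\sum_i x_i$ and standard deviation $\hat\sigma=\bigl(\frac1n\sum_i(x_i-\hat\mu)^2\bigr)^{1/2}$, the algorithm \textsf{binmedian} works as follows. It starts with all $n$ points under consideration, with the range $[\ell,h]=[\hat\mu-\hat\sigma,\hat\mu+\hat\sigma]$ and with $N_L$ the number of points to the left of this range. In one iteration it divides $[\ell,h]$ into $B$ bins of equal length, the $i$-th one ($i=0,\dots,B-1$) being $\ell+\bigl[\frac iB(h-\ell),\frac{i+1}B(h-\ell)\bigr)$, the last one together with the right endpoint $h$; it counts the number $N_i$ of points under consideration in the $i$-th bin, finds the least $b$ with $N_L+\sum_{i=0}^{b}N_i\ge\frac{n+1}2$ (the median bin), keeps only the points in bin $b$, replaces $N_L$ by $N_L+\sum_{i=0}^{b-1}N_i$, and takes bin $b$ as the new range. It stops when only one point is left. In the modified version of the algorithm, whenever the median bin contains all the points under consideration at that iteration, the new range is the interval from the smallest to the largest of these points instead of bin $b$. Let $T$ be the number of iterations before the algorithm stops ($T=\infty$ if it never stops). Let $X_1,X_2,\dots$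 be independent and identically distributed real random variables whose distribution has a bounded density $f$, and suppose that $\mathrm E(X_1^4)<\infty$. For odd $n$ let $T_n$ be the number of iterations of \textsf{binmedian}, in its basic or in its modified version, on the data $X_1,\dots,X_n$. Then $T_n$ is a random variable and $\mathrm E(T_n)=O(\log n)$: there is a constant $K$, which depends only on $B$, the version of the algorithm and the distribution of $X_1$, such that $\mathrm E(T_n)\le K\log n$ for every odd $n$. -/

import Mathlib

open MeasureTheory ProbabilityTheory
open scoped ENNReal

noncomputable section

namespace Binmedian

/-- The mean of the data points `x 0, …, x (n - 1)`. -/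
def mean {n : ℕ} (x : Fin n → ℝ) : ℝ := (∑ p, x p) / n

/-- The standard deviation of the data points (normalised by `n`). -/
def stdDev {n : ℕ} (x : Fin n → ℝ) : ℝ := √((∑ p, (x p - mean x) ^ 2) / n)

/-- The state of the algorithm between two iterations: the range `[lo, hi]` that is about to be
divided into bins, the number `numLeft` of data points to the left of that range, and the (indices
of the) points that are still under consideration. -/
structure State (n : ℕ) where
  lo : ℝ
  hi : ℝ
  numLeft : ℕ
  pts : Finset (Fin n)

/-- At the start all points are under consideration and the range is `[μ - σ, μ + σ]`. -/
def init {n : ℕ} (x : Fin n → ℝ) : State n where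
  lo := mean x - stdDev x
  hi := mean x + stdDev x
  numLeft := (Finset.univ.filter fun p => x p < mean x - stdDev x).card
  pts := Finset.univ

/-- The left endpoint of the `i`-th of `B` equally spaced bins across `[lo, hi]`
(and the right endpoint of the bin before it). -/
def State.edge {n : ℕ} (B : ℕ) (s : State n) (i : ℕ) : ℝ :=
  s.lo + (i : ℝ) / B * (s.hi - s.lo)

/-- The points under consideration that are mapped to the `i`-th bin `[edge i, edge (i + 1))`,
`i = 0, …, B - 1`. The last bin also receives the points that are equal to `hi`, so that the bins
cover the closed range `[lo, hi]`. -/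
def State.bin {n : ℕ} (B : ℕ) (x : Fin n → ℝ) (s : State n) (i : ℕ) : Finset (Fin n) :=
  s.pts.filter fun p =>
    s.edge B i ≤ x p ∧ (x p < s.edge B (i + 1) ∨ (i + 1 = B ∧ x p = s.hi))

/-- The bin that contains the median: the least `b` in `{0, …, B - 1}` such that
`N_L + ∑_{i ≤ b} N_i ≥ (n + 1) / 2` (`n` is odd). -/
def State.medianBin {n : ℕ} (B : ℕ) (x : Fin n → ℝ) (s : State n) : ℕ :=
  sInf {b : ℕ | b < B ∧
    (n + 1) / 2 ≤ s.numLeft + ∑ i ∈ Finset.range (b + 1), (s.bin B x i).card}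

/-- One iteration. The points in the median bin are kept, and the next range is the median bin;
in the modified algorithm (`modified = true`), if the median bin contains all the points of the
present iteration, the next range goes from the smallest to the largest of them instead. -/
def State.step {n : ℕ} (modified : Bool) (B : ℕ) (x : Fin n → ℝ) (s : State n) : State n :=
  let b := s.medianBin B x
  let S := s.bin B x b
  let L := s.numLeft + ∑ i ∈ Finset.range b, (s.bin B x i).card
  if modified = true ∧ S = s.pts then
    { lo := sInf (x '' (S : Set (Fin n))), hi := sSup (x '' (S : Set (Fin n))),
      numLeft := L, pts := S }
  else
    { lo := s.edge B b, hi := s.edge B (b + 1), numLeft := L, pts := S }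

/-- The state after `j` iterations. -/
def stateAt {n : ℕ} (modified : Bool) (B : ℕ) (x : Fin n → ℝ) (j : ℕ) : State n :=
  (State.step modified B x)^[j] (init x)

/-- The number of points left after `j` iterations. -/
def numPoints {n : ℕ} (modified : Bool) (B : ℕ) (x : Fin n → ℝ) (j : ℕ) : ℕ :=
  (stateAt modified B x j).pts.card

/-- The number of iterations until only one point is left; `⊤` if that never happens. -/
def numIterations {n : ℕ} (modified : Bool) (B : ℕ) (x : Fin n → ℝ) : ℕ∞ :=
  ⨅ (j : ℕ) (_ : numPoints modified B x j = 1), (j : ℕ∞)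

end Binmedian

end

namespace Binmedian

variable {n : ℕ}

/-! ### The median lies in the initial range -/

/-! Survival of the algorithm forces two data points to be close. Fewer than half of the points lie
beyond one standard deviation on either side, so the median is in the initial range; this persists
(`hasMedian_stateAt`), so at least one point is always left. The range shrinks by a factor `B ≥ 2`
per iteration, in both versions. If iteration `j ≥ 1` leaves more than one point, two of them are
within `2σ / B ^ j` (`exists_close_of_numPoints_ne_one`).

Then either some pair is within `(3/4) ^ j`, or `σ ^ 2 ≥ (9/4) ^ j / 4`. The bounded density and a
union bound over pairs control the first event by a multiple of `n ^ 2 * (3/4) ^ j`; Markov's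
inequality for the second moment controls the other (`measure_numPoints_ne_one_le`). Summing `min
(1, C * n ^ 2 * (3/4) ^ j)` over `j` gives `O(log n)`: the bound 1 is used for about `log n` terms,
and the geometric tail is bounded. -/

theorem sum_sub_mean (hn : 0 < n) (x : Fin n → ℝ) : ∑ p, (x p - mean x) = 0 := by
  have : (n : ℝ) ≠ 0 := by positivity
  rw [Finset.sum_sub_distrib]
  simp only [mean, Finset.sum_const, Finset.card_univ, Fintype.card_fin, nsmul_eq_mul]
  field_simp
  ring

theorem stdDev_nonneg (x : Fin n → ℝ) : 0 ≤ stdDev x := Real.sqrt_nonneg _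

theorem sq_stdDev (x : Fin n → ℝ) : stdDev x ^ 2 = (∑ p, (x p - mean x) ^ 2) / n :=
  Real.sq_sqrt (by positivity)

theorem sum_sq_sub_mean (hn : 0 < n) (x : Fin n → ℝ) :
    ∑ p, (x p - mean x) ^ 2 = n * stdDev x ^ 2 := by
  have : (n : ℝ) ≠ 0 := by positivity
  rw [sq_stdDev]
  field_simp

/-- The sum of the squared deviations from `mean x - c`, where `c ^ 2` is the variance. -/
theorem sum_sq_sub_mean_add (hn : 0 < n) (x : Fin n → ℝ) {c : ℝ} (hc : c ^ 2 = stdDev x ^ 2) :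
    ∑ p, (x p - mean x + c) ^ 2 = 2 * n * stdDev x ^ 2 := by
  have h : ∀ p, (x p - mean x + c) ^ 2 = (x p - mean x) ^ 2 + 2 * c * (x p - mean x) + c ^ 2 :=
    fun p => by ring
  simp only [h, Finset.sum_add_distrib, ← Finset.mul_sum, sum_sub_mean hn, sum_sq_sub_mean hn,
    Finset.sum_const, Finset.card_univ, Fintype.card_fin, nsmul_eq_mul, hc]
  ring

/-- A one-sided Chebyshev inequality: fewer than half of the points deviate from the mean
by more than one standard deviation on a given side. -/
theorem two_mul_card_lt_of_sq_lt (hn : 0 < n) (x : Fin n → ℝ) {c : ℝ} (hc : c ^ 2 = stdDev x ^ 2)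
    (S : Finset (Fin n)) (hS : ∀ p ∈ S, (2 * c) ^ 2 < (x p - mean x + c) ^ 2) :
    2 * S.card < n := by
  rcases S.eq_empty_or_nonempty with rfl | hne
  · simpa using hn
  -- Each term over `S` exceeds `4σ²`, while the sum over all points is `2nσ²`.
  have h1 : ∑ _p ∈ S, (2 * c) ^ 2 < ∑ p ∈ S, (x p - mean x + c) ^ 2 :=
    Finset.sum_lt_sum_of_nonempty hne hS
  have h2 : ∑ p ∈ S, (x p - mean x + c) ^ 2 ≤ ∑ p, (x p - mean x + c) ^ 2 :=
    Finset.sum_le_sum_of_subset_of_nonneg (Finset.subset_univ _) fun _ _ _ => sq_nonneg _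
  rw [sum_sq_sub_mean_add hn x hc] at h2
  simp only [Finset.sum_const, nsmul_eq_mul, mul_pow, hc] at h1
  have h3 : ((2 * S.card : ℕ) : ℝ) * stdDev x ^ 2 < n * stdDev x ^ 2 := by
    push_cast; linarith
  -- If `σ = 0`, then `h3` is already absurd, so no case split is needed.
  exact_mod_cast lt_of_mul_lt_mul_right h3 (sq_nonneg _)

theorem two_mul_card_lt_lo (hn : 0 < n) (x : Fin n → ℝ) :
    2 * (Finset.univ.filter fun p => x p < mean x - stdDev x).card < n := by
  refine two_mul_card_lt_of_sq_lt hn x (c := -stdDev x) (by ring) _ fun p hp => ?_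
  simp only [Finset.mem_filter, Finset.mem_univ, true_and] at hp
  have := stdDev_nonneg x
  nlinarith

theorem two_mul_card_hi_lt (hn : 0 < n) (x : Fin n → ℝ) :
    2 * (Finset.univ.filter fun p => mean x + stdDev x < x p).card < n := by
  refine two_mul_card_lt_of_sq_lt hn x (c := stdDev x) rfl _ fun p hp => ?_
  simp only [Finset.mem_filter, Finset.mem_univ, true_and] at hp
  have := stdDev_nonneg x
  nlinarith

/-! ### The invariant of the iteration -/

/-- The points under consideration that lie in the present range. -/
noncomputable def State.inRange (x : Fin n → ℝ) (s : State n) : Finset (Fin n) :=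
  s.pts.filter fun p => s.lo ≤ x p ∧ x p ≤ s.hi

/-- The `(n + 1) / 2`-th smallest point lies in the present range. -/
structure State.HasMedian (x : Fin n → ℝ) (s : State n) : Prop where
  lo_le_hi : s.lo ≤ s.hi
  numLeft_lt : s.numLeft < (n + 1) / 2
  le_card : (n + 1) / 2 ≤ s.numLeft + (s.inRange x).card

theorem hasMedian_init (hn : Odd n) (x : Fin n → ℝ) : (init x).HasMedian x := by
  have h1 := two_mul_card_lt_lo hn.pos x
  have h2 := two_mul_card_hi_lt hn.pos x
  refine ⟨?_, ?_, ?_⟩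
  · have := stdDev_nonneg x
    simp only [init]; linarith
  · simp only [init]; omega
  · have h3 : (Finset.univ : Finset (Fin n)) ⊆
        ((Finset.univ.filter fun p => x p < mean x - stdDev x) ∪ (init x).inRange x) ∪
          Finset.univ.filter fun p => mean x + stdDev x < x p := by
      intro p _
      simp only [Finset.mem_union, Finset.mem_filter, Finset.mem_univ, true_and]
      rcases lt_or_ge (x p) (mean x - stdDev x) with h | h
      · exact Or.inl (Or.inl h)
      rcases lt_or_ge (mean x + stdDev x) (x p) with h' | h'
      · exact Or.inr h'
      · exact Or.inl (Or.inr (Finset.mem_filter.2 ⟨Finset.mem_univ p, h, h'⟩))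
    have h4 := (Finset.card_le_card h3).trans (Finset.card_union_le _ _)
    have h5 := Finset.card_union_le (Finset.univ.filter fun p => x p < mean x - stdDev x)
      ((init x).inRange x)
    rw [Finset.card_univ, Fintype.card_fin] at h4
    obtain ⟨k, hk⟩ := hn
    simp only [init] at *
    omega

/-! ### Bins, the median bin and the new range. -/

theorem State.edge_zero (B : ℕ) (s : State n) : s.edge B 0 = s.lo := by simp [State.edge]

theorem State.edge_self {B : ℕ} (hB : B ≠ 0) (s : State n) : s.edge B B = s.hi := by
  have : (B : ℝ) ≠ 0 := by exact_mod_cast hB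
  simp [State.edge, div_self this]

theorem State.edge_mono (B : ℕ) {s : State n} (hs : s.lo ≤ s.hi) : Monotone (s.edge B) := by
  intro i j hij
  have : (i : ℝ) ≤ j := by exact_mod_cast hij
  have h : 0 ≤ s.hi - s.lo := by linarith
  simp only [State.edge]
  gcongr

theorem State.edge_succ_sub (B : ℕ) (s : State n) (i : ℕ) :
    s.edge B (i + 1) - s.edge B i = (s.hi - s.lo) / B := by
  simp only [State.edge]; push_cast; ring

/-- The bins cover the range. -/
theorem State.inRange_subset {B : ℕ} (hB : B ≠ 0) (x : Fin n → ℝ) {s : State n}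
    (hs : s.lo ≤ s.hi) :
    s.inRange x ⊆ (Finset.range B).biUnion (s.bin B x) := by
  intro p hp
  simp only [State.inRange, Finset.mem_filter] at hp
  obtain ⟨hp, hlo, hhi⟩ := hp
  simp only [Finset.mem_biUnion, Finset.mem_range, State.bin, Finset.mem_filter]
  obtain ⟨C, rfl⟩ := Nat.exists_eq_succ_of_ne_zero hB
  rcases hhi.eq_or_lt with h | h
  · refine ⟨C, C.lt_succ_self, hp, ?_, Or.inr ⟨rfl, h⟩⟩
    rw [h, ← s.edge_self hB]
    exact State.edge_mono _ hs C.le_succ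
  -- The bin of `p` ends at the first right edge beyond `x p`; minimality puts its left edge at or
  -- below `x p`.
  · have hex : ∃ i, x p < s.edge (C + 1) (i + 1) := ⟨C, by rw [s.edge_self hB]; exact h⟩
    classical
    refine ⟨Nat.find hex, Nat.lt_succ_of_le (Nat.find_min' hex (by rw [s.edge_self hB]; exact h)),
      hp, ?_, Or.inl (Nat.find_spec hex)⟩
    rcases Nat.eq_zero_or_pos (Nat.find hex) with h0 | h0
    · rw [h0, State.edge_zero]; exact hlo
    · have := Nat.find_min hex (Nat.sub_lt h0 one_pos)
      rwa [Nat.sub_add_cancel (show 1 ≤ Nat.find hex from h0), not_lt] at this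

/-- The number of points to the left of the median bin. -/
noncomputable def State.newLeft (B : ℕ) (x : Fin n → ℝ) (s : State n) : ℕ :=
  s.numLeft + ∑ i ∈ Finset.range (s.medianBin B x), (s.bin B x i).card

theorem State.HasMedian.medianBin_spec {B : ℕ} (hB : B ≠ 0) {x : Fin n → ℝ} {s : State n}
    (hs : s.HasMedian x) :
    s.medianBin B x < B ∧ s.newLeft B x < (n + 1) / 2 ∧
      (n + 1) / 2 ≤ s.newLeft B x + (s.bin B x (s.medianBin B x)).card := by
  -- Without a member, `sInf` would be the junk value 0. The last bin qualifies because the bins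
  -- cover the range.
  have hne : {b : ℕ | b < B ∧
      (n + 1) / 2 ≤ s.numLeft + ∑ i ∈ Finset.range (b + 1), (s.bin B x i).card}.Nonempty := by
    refine ⟨B - 1, by omega, ?_⟩
    rw [Nat.sub_add_cancel (Nat.pos_of_ne_zero hB)]
    have h1 := Finset.card_le_card (State.inRange_subset hB x hs.lo_le_hi)
    have h2 : ((Finset.range B).biUnion (s.bin B x)).card ≤ _ := Finset.card_biUnion_le
    have h3 := hs.le_card
    omega
  have hmem : s.medianBin B x ∈ _ := Nat.sInf_mem hne
  obtain ⟨h1, h2⟩ := hmem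
  refine ⟨h1, ?_, ?_⟩
  · unfold State.newLeft
    rcases Nat.eq_zero_or_pos (s.medianBin B x) with h0 | h0
    · simpa [h0] using hs.numLeft_lt
    · have h3 : s.medianBin B x - 1 ∉ _ := Nat.notMem_of_lt_sInf
        (show s.medianBin B x - 1 < sInf _ from Nat.sub_lt h0 one_pos)
      simp only [Set.mem_ofPred_eq, Nat.sub_add_cancel h0, not_and, not_le] at h3
      exact h3 (by omega)
  · rw [Finset.sum_range_succ] at h2
    unfold State.newLeft
    omega

theorem State.step_pts (modified : Bool) (B : ℕ) (x : Fin n → ℝ) (s : State n) :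
    (s.step modified B x).pts = s.bin B x (s.medianBin B x) := by
  simp only [State.step]; split_ifs <;> rfl

theorem State.step_numLeft (modified : Bool) (B : ℕ) (x : Fin n → ℝ) (s : State n) :
    (s.step modified B x).numLeft = s.newLeft B x := by
  simp only [State.step]; split_ifs <;> rfl

theorem State.mem_bin_le {B : ℕ} {x : Fin n → ℝ} {s : State n} {i : ℕ} {p : Fin n}
    (hB : B ≠ 0) (hp : p ∈ s.bin B x i) : s.edge B i ≤ x p ∧ x p ≤ s.edge B (i + 1) := by
  simp only [State.bin, Finset.mem_filter] at hp
  refine ⟨hp.2.1, ?_⟩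
  rcases hp.2.2 with h | ⟨h, h'⟩
  · exact h.le
  · rw [h, s.edge_self hB, h']

/-- After a step, every remaining point lies in the new range, which is shorter by a factor
of at least `B`. -/
theorem State.HasMedian.step_range {B : ℕ} (hB : B ≠ 0) (modified : Bool) {x : Fin n → ℝ}
    {s : State n} (hs : s.HasMedian x) :
    (∀ p ∈ (s.step modified B x).pts,
      (s.step modified B x).lo ≤ x p ∧ x p ≤ (s.step modified B x).hi) ∧
    (s.step modified B x).hi - (s.step modified B x).lo ≤ (s.hi - s.lo) / B := by
  obtain ⟨_, h2, h3⟩ := hs.medianBin_spec (B := B) hB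
  have hne : (s.bin B x (s.medianBin B x)).Nonempty := by
    rw [← Finset.card_pos]; omega
  rw [State.step_pts]
  have hfin : (x '' (s.bin B x (s.medianBin B x) : Set (Fin n))).Finite :=
    (Finset.finite_toSet _).image x
  have hlen := s.edge_succ_sub B (s.medianBin B x)
  simp only [State.step]
  split_ifs with h
  · refine ⟨fun p hp => ⟨csInf_le hfin.bddBelow ⟨p, hp, rfl⟩, le_csSup hfin.bddAbove ⟨p, hp, rfl⟩⟩,
      ?_⟩
    have hne' : (x '' (s.bin B x (s.medianBin B x) : Set (Fin n))).Nonempty := hne.to_set.image x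
    have h4 : s.edge B (s.medianBin B x) ≤ sInf (x '' (s.bin B x (s.medianBin B x) : Set _)) :=
      le_csInf hne' (by rintro _ ⟨p, hp, rfl⟩; exact (State.mem_bin_le hB hp).1)
    have h5 : sSup (x '' (s.bin B x (s.medianBin B x) : Set _)) ≤ s.edge B (s.medianBin B x + 1) :=
      csSup_le hne' (by rintro _ ⟨p, hp, rfl⟩; exact (State.mem_bin_le hB hp).2)
    linarith
  · exact ⟨fun p hp => State.mem_bin_le hB hp, hlen.le⟩

theorem State.HasMedian.step {B : ℕ} (hB : B ≠ 0) (modified : Bool) {x : Fin n → ℝ}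
    {s : State n} (hs : s.HasMedian x) : (s.step modified B x).HasMedian x := by
  obtain ⟨_, h2, h3⟩ := hs.medianBin_spec (B := B) hB
  have h4 := (hs.step_range hB modified).1
  have h5 : (s.step modified B x).inRange x = s.bin B x (s.medianBin B x) := by
    rw [State.inRange, Finset.filter_true_of_mem h4, State.step_pts]
  refine ⟨?_, by rwa [State.step_numLeft], by rwa [State.step_numLeft, h5]⟩
  have hne : (s.step modified B x).pts.Nonempty := by
    rw [← Finset.card_pos, State.step_pts]; omega
  obtain ⟨p, hp⟩ := hne
  exact (h4 p hp).1.trans (h4 p hp).2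

theorem stateAt_succ (modified : Bool) (B : ℕ) (x : Fin n → ℝ) (j : ℕ) :
    stateAt modified B x (j + 1) = (stateAt modified B x j).step modified B x :=
  Function.iterate_succ_apply' _ _ _

theorem hasMedian_stateAt (hn : Odd n) {B : ℕ} (hB : B ≠ 0) (modified : Bool) (x : Fin n → ℝ)
    (j : ℕ) : (stateAt modified B x j).HasMedian x := by
  induction j with
  | zero => exact hasMedian_init hn x
  | succ j ih => rw [stateAt_succ]; exact ih.step hB modified

theorem stateAt_length_le (hn : Odd n) {B : ℕ} (hB : B ≠ 0) (modified : Bool) (x : Fin n → ℝ)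
    (j : ℕ) :
    (stateAt modified B x j).hi - (stateAt modified B x j).lo ≤ 2 * stdDev x / B ^ j := by
  induction j with
  | zero => simp only [stateAt, Function.iterate_zero, id, init, pow_zero, div_one]; linarith
  | succ j ih =>
    rw [stateAt_succ]
    refine ((hasMedian_stateAt hn hB modified x j).step_range hB modified).2.trans ?_
    rw [pow_succ, ← div_div]
    gcongr

/-- If more than one point is left after `j + 1` iterations, then two of the data points are close
to each other. -/
theorem exists_close_of_numPoints_ne_one (hn : Odd n) {B : ℕ} (hB : B ≠ 0) (modified : Bool)
    (x : Fin n → ℝ) (j : ℕ) (h : numPoints modified B x (j + 1) ≠ 1) :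
    ∃ p q, p ≠ q ∧ |x p - x q| ≤ 2 * stdDev x / B ^ (j + 1) := by
  have hm := hasMedian_stateAt hn hB modified x (j + 1)
  have h1 : 1 ≤ (stateAt modified B x (j + 1)).pts.card := by
    have h2 := hm.numLeft_lt
    have h3 := hm.le_card
    have h4 : ((stateAt modified B x (j + 1)).inRange x).card ≤ _ :=
      Finset.card_le_card (Finset.filter_subset _ _)
    omega
  have h2 : 1 < (stateAt modified B x (j + 1)).pts.card := lt_of_le_of_ne h1 (Ne.symm h)
  obtain ⟨p, hp, q, hq, hpq⟩ := Finset.one_lt_card.1 h2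
  refine ⟨p, q, hpq, le_trans ?_ (stateAt_length_le hn hB modified x (j + 1))⟩
  -- This needs at least one iteration: initially, points outside the range are also under
  -- consideration.
  have hr := ((hasMedian_stateAt hn hB modified x j).step_range hB modified).1
  rw [← stateAt_succ] at hr
  have := hr p hp
  have := hr q hq
  rw [abs_le]; constructor <;> linarith

/-! ### The number of iterations as a sum -/

/-- A first hitting time counts the times before it. Quantifying over all `i ≤ k` makes these times
an initial segment even if `Q` can fail again after a hit. -/
theorem coe_iInf_eq_tsum (Q : ℕ → Prop) :
    (((⨅ (j : ℕ) (_ : Q j), (j : ℕ∞)) : ℕ∞) : ℝ≥0∞) =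
      ∑' j : ℕ, {k : ℕ | ∀ i ≤ k, ¬ Q i}.indicator 1 j := by
  classical
  by_cases hex : ∃ j, Q j
  · have h1 : (⨅ (j : ℕ) (_ : Q j), (j : ℕ∞)) = (Nat.find hex : ℕ) := by
      refine le_antisymm (iInf₂_le _ (Nat.find_spec hex)) (le_iInf₂ fun j hj => ?_)
      exact_mod_cast Nat.find_min' hex hj
    have h2 : {k : ℕ | ∀ i ≤ k, ¬ Q i} = ((Finset.range (Nat.find hex) : Finset ℕ) : Set ℕ) := by
      ext k
      simp only [Set.mem_ofPred_eq, Finset.coe_range, Set.mem_Iio, Nat.lt_find_iff]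
    rw [h1, h2, ← tsum_subtype]
    simp
  · push Not at hex
    have h2 : {k : ℕ | ∀ i ≤ k, ¬ Q i} = Set.univ := by ext k; simp [hex]
    rw [h2]
    simp [hex]

end Binmedian

namespace Binmedian

variable {n : ℕ}

/-! ### Measurability -/

theorem numIterations_eq_tsum (modified : Bool) (B : ℕ) (x : Fin n → ℝ) :
    ((numIterations modified B x : ℕ∞) : ℝ≥0∞) =
      ∑' j : ℕ, {y : Fin n → ℝ | ∀ i ≤ j, numPoints modified B y i ≠ 1}.indicator 1 x :=
  coe_iInf_eq_tsum _

/-- The discrete measurable structure on sets of indices. -/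
local instance instMeasurableSpaceFinset : MeasurableSpace (Finset (Fin n)) := ⊤

/-- A state that depends measurably on the data. -/
structure MeasurableState (s : (Fin n → ℝ) → State n) : Prop where
  lo : Measurable fun x => (s x).lo
  hi : Measurable fun x => (s x).hi
  numLeft : Measurable fun x => (s x).numLeft
  pts : Measurable fun x => (s x).pts

theorem measurable_finset {α : Type*} [MeasurableSpace α] {S : α → Finset (Fin n)}
    (h : ∀ p, MeasurableSet {a | p ∈ S a}) : Measurable S := by
  refine measurable_to_countable' fun T => ?_
  have : S ⁻¹' {T} = ⋂ p, {a | p ∈ S a ↔ p ∈ T} := by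
    ext a; simp [Finset.ext_iff]
  rw [this]
  refine MeasurableSet.iInter fun p => ?_
  by_cases hp : p ∈ T
  · simpa [hp] using h p
  · have h' := (h p).compl
    rw [Set.compl_ofPred] at h'
    simpa only [hp, iff_false] using h'

theorem measurable_sInf_nat {α : Type*} [MeasurableSpace α] {A : α → Set ℕ}
    (h : ∀ b, MeasurableSet {a | b ∈ A a}) : Measurable fun a => sInf (A a) := by
  refine measurable_to_countable' fun k => ?_
  -- The second alternative accounts for `sInf ∅ = 0`.
  have h1 : MeasurableSet {a | (k ∈ A a ∧ ∀ i < k, i ∉ A a) ∨ (k = 0 ∧ ∀ i, i ∉ A a)} := by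
    simp only [Set.ofPred_or, Set.ofPred_and, Set.ofPred_forall]
    refine ((h k).inter ?_).union ((MeasurableSet.const _).inter ?_)
    · exact MeasurableSet.iInter fun i => MeasurableSet.iInter fun _ => (h i).compl
    · exact MeasurableSet.iInter fun i => (h i).compl
  convert h1 using 1
  ext a
  simp only [Set.mem_preimage, Set.mem_singleton_iff, Set.mem_ofPred_eq]
  rcases (A a).eq_empty_or_nonempty with he | hne
  · simp [he, eq_comm]
  · constructor
    · rintro rfl
      exact Or.inl ⟨Nat.sInf_mem hne, fun i hi => Nat.notMem_of_lt_sInf hi⟩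
    · rintro (⟨h2, h3⟩ | ⟨_, h2⟩)
      · exact le_antisymm (Nat.sInf_le h2) (not_lt.1 fun hlt => h3 _ hlt (Nat.sInf_mem hne))
      · exact absurd hne.some_mem (h2 _)

theorem measurable_mean : Measurable (mean : (Fin n → ℝ) → ℝ) := by
  unfold mean; fun_prop

theorem measurable_stdDev : Measurable (stdDev : (Fin n → ℝ) → ℝ) := by
  have := measurable_mean (n := n)
  unfold stdDev; fun_prop

theorem measurableState_init : MeasurableState (init : (Fin n → ℝ) → State n) := by
  have h1 := measurable_mean (n := n)
  have h2 := measurable_stdDev (n := n)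
  refine ⟨h1.sub h2, h1.add h2, ?_, measurable_const⟩
  have h3 : Measurable fun x : Fin n → ℝ =>
      Finset.univ.filter fun p => x p < mean x - stdDev x := by
    refine measurable_finset fun p => ?_
    simp only [Finset.mem_filter, Finset.mem_univ, true_and]
    exact measurableSet_lt (measurable_pi_apply p) (h1.sub h2)
  exact (Measurable.of_discrete (f := Finset.card)).comp h3

theorem State.step_lo (modified : Bool) (B : ℕ) (x : Fin n → ℝ) (s : State n) :
    (s.step modified B x).lo =
      if modified = true ∧ s.bin B x (s.medianBin B x) = s.pts then
        sInf (x '' (s.bin B x (s.medianBin B x) : Set (Fin n)))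
      else s.edge B (s.medianBin B x) := by
  simp only [State.step]; split_ifs <;> rfl

theorem State.step_hi (modified : Bool) (B : ℕ) (x : Fin n → ℝ) (s : State n) :
    (s.step modified B x).hi =
      if modified = true ∧ s.bin B x (s.medianBin B x) = s.pts then
        sSup (x '' (s.bin B x (s.medianBin B x) : Set (Fin n)))
      else s.edge B (s.medianBin B x + 1) := by
  simp only [State.step]; split_ifs <;> rfl

namespace MeasurableState

variable {s : (Fin n → ℝ) → State n}

theorem edge (hs : MeasurableState s) (B : ℕ) (i : ℕ) : Measurable fun x => (s x).edge B i := by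
  have := hs.lo
  have := hs.hi
  unfold State.edge; fun_prop

theorem bin (hs : MeasurableState s) (B : ℕ) (i : ℕ) : Measurable fun x => (s x).bin B x i := by
  refine measurable_finset fun p => ?_
  simp only [State.bin, Finset.mem_filter]
  have h1 : MeasurableSet {x | p ∈ (s x).pts} :=
    hs.pts (MeasurableSet.of_discrete (s := {S : Finset (Fin n) | p ∈ S}))
  have h2 : MeasurableSet {x | (s x).edge B i ≤ x p} :=
    measurableSet_le (hs.edge B i) (measurable_pi_apply p)
  have h3 : MeasurableSet {x | x p < (s x).edge B (i + 1)} :=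
    measurableSet_lt (measurable_pi_apply p) (hs.edge B (i + 1))
  have h4 : MeasurableSet {x | x p = (s x).hi} :=
    measurableSet_eq_fun (measurable_pi_apply p) hs.hi
  exact h1.inter (h2.inter (h3.union ((MeasurableSet.const _).inter h4)))

theorem numLeft_add_sum (hs : MeasurableState s) (B : ℕ) (b : ℕ) : Measurable fun x =>
    (s x).numLeft + ∑ i ∈ Finset.range b, ((s x).bin B x i).card :=
  hs.numLeft.add (Finset.measurable_fun_sum _ fun i _ =>
    (Measurable.of_discrete (f := Finset.card)).comp (hs.bin B i))

theorem medianBin (hs : MeasurableState s) (B : ℕ) : Measurable fun x => (s x).medianBin B x := by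
  refine measurable_sInf_nat fun b => ?_
  exact (MeasurableSet.const _).inter
    (measurableSet_le measurable_const (hs.numLeft_add_sum B (b + 1)))

/-- The index of the median bin depends on the data. Joint measurability in data and index follows
from measurability at each of countably many indices; the measurable index is then substituted. -/
theorem step (hs : MeasurableState s) (B : ℕ) (modified : Bool) :
    MeasurableState fun x => (s x).step modified B x := by
  have hb := hs.medianBin B
  have hS : Measurable fun x => (s x).bin B x ((s x).medianBin B x) :=
    (measurable_from_prod_countable_left (f := fun q : (Fin n → ℝ) × ℕ => (s q.1).bin B q.1 q.2)
      fun i => hs.bin B i).comp (measurable_id.prodMk hb)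
  have hedge : Measurable fun q : (Fin n → ℝ) × ℕ => (s q.1).edge B q.2 :=
    measurable_from_prod_countable_left fun i => hs.edge B i
  have hc : MeasurableSet {x | modified = true ∧ (s x).bin B x ((s x).medianBin B x) = (s x).pts} :=
    (MeasurableSet.const _).inter (measurableSet_eq_fun hS hs.pts)
  have hinf : Measurable fun q : (Fin n → ℝ) × Finset (Fin n) =>
      sInf (q.1 '' (q.2 : Set (Fin n))) := by
    refine measurable_from_prod_countable_left fun S => ?_
    simp only [sInf_image']
    exact Measurable.iInf fun p => measurable_pi_apply _
  have hsup : Measurable fun q : (Fin n → ℝ) × Finset (Fin n) =>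
      sSup (q.1 '' (q.2 : Set (Fin n))) := by
    refine measurable_from_prod_countable_left fun S => ?_
    simp only [sSup_image']
    exact Measurable.iSup fun p => measurable_pi_apply _
  refine ⟨?_, ?_, ?_, ?_⟩
  · have h1 := hinf.comp (measurable_id.prodMk hS)
    have h2 := hedge.comp (measurable_id.prodMk hb)
    simp only [State.step_lo]
    exact Measurable.ite hc h1 h2
  · have h1 := hsup.comp (measurable_id.prodMk hS)
    have h2 := hedge.comp (measurable_id.prodMk (hb.add_const 1))
    simp only [State.step_hi]
    exact Measurable.ite hc h1 h2
  · simp only [State.step_numLeft, State.newLeft]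
    exact (measurable_from_prod_countable_left (f := fun q : (Fin n → ℝ) × ℕ =>
      (s q.1).numLeft + ∑ i ∈ Finset.range q.2, ((s q.1).bin B q.1 i).card)
      fun b => hs.numLeft_add_sum B b).comp (measurable_id.prodMk hb)
  · simpa only [State.step_pts] using hS

end MeasurableState

theorem measurableState_stateAt (modified : Bool) (B j : ℕ) :
    MeasurableState fun x : Fin n → ℝ => stateAt modified B x j := by
  induction j with
  | zero => exact measurableState_init
  | succ j ih => simpa only [stateAt_succ] using ih.step B modified

theorem measurableSet_numPoints_ne_one (modified : Bool) (B j : ℕ) :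
    MeasurableSet {x : Fin n → ℝ | ∀ i ≤ j, numPoints modified B x i ≠ 1} := by
  have h : ∀ i, MeasurableSet {x : Fin n → ℝ | numPoints modified B x i ≠ 1} := fun i =>
    (measurableState_stateAt modified B i).pts
      (MeasurableSet.of_discrete (s := {S : Finset (Fin n) | S.card ≠ 1}))
  simp only [Set.ofPred_forall]
  exact MeasurableSet.iInter fun i => MeasurableSet.iInter fun _ => h i

theorem measurable_numIterations (modified : Bool) (B : ℕ) :
    Measurable fun x : Fin n → ℝ => ((numIterations modified B x : ℕ∞) : ℝ≥0∞) := by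
  simp only [numIterations_eq_tsum]
  exact Measurable.tsum fun j =>
    measurable_one.indicator (measurableSet_numPoints_ne_one modified B j)

end Binmedian

namespace Binmedian

/-! ### Tail bounds -/

theorem withDensity_le_mul_volume {f : ℝ → ℝ} {M : ℝ} (hM : ∀ t, f t ≤ M) {A : Set ℝ}
    (hA : MeasurableSet A) :
    (volume.withDensity fun t => ENNReal.ofReal (f t)) A ≤ ENNReal.ofReal M * volume A := by
  rw [withDensity_apply _ hA, ← setLIntegral_const]
  exact lintegral_mono fun t => ENNReal.ofReal_le_ofReal (hM t)

/-- Two independent random variables, one of which has a bounded density, are rarely close. -/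
theorem measure_abs_sub_le {Ω : Type*} [MeasurableSpace Ω] {P : Measure Ω}
    [IsProbabilityMeasure P] {Y Z : Ω → ℝ} (hY : Measurable Y) (hZ : Measurable Z)
    (hYZ : IndepFun Y Z P) {f : ℝ → ℝ}
    (hdens : P.map Z = volume.withDensity fun t => ENNReal.ofReal (f t))
    {M : ℝ} (hM0 : 0 ≤ M) (hM : ∀ t, f t ≤ M) (δ : ℝ) :
    P {ω | |Y ω - Z ω| ≤ δ} ≤ ENNReal.ofReal (2 * M * δ) := by
  have hms : MeasurableSet {q : ℝ × ℝ | |q.1 - q.2| ≤ δ} :=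
    measurableSet_le (by fun_prop) measurable_const
  have hYm : IsProbabilityMeasure (P.map Y) := Measure.isProbabilityMeasure_map hY.aemeasurable
  have hZm : IsProbabilityMeasure (P.map Z) := Measure.isProbabilityMeasure_map hZ.aemeasurable
  have h1 : P {ω | |Y ω - Z ω| ≤ δ} =
      ((P.map Y).prod (P.map Z)) {q : ℝ × ℝ | |q.1 - q.2| ≤ δ} := by
    rw [← (indepFun_iff_map_prod_eq_prod_map_map hY.aemeasurable hZ.aemeasurable).1 hYZ,
      Measure.map_apply (hY.prodMk hZ) hms]
    rfl
  rw [h1, Measure.prod_apply hms]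
  calc ∫⁻ y, P.map Z (Prod.mk y ⁻¹' {q : ℝ × ℝ | |q.1 - q.2| ≤ δ}) ∂(P.map Y)
      ≤ ∫⁻ _, ENNReal.ofReal (2 * M * δ) ∂(P.map Y) := by
        refine lintegral_mono fun y => ?_
        -- For fixed `y`, `Z` must fall in an interval of length `2δ`.
        have h2 : Prod.mk y ⁻¹' {q : ℝ × ℝ | |q.1 - q.2| ≤ δ} = Metric.closedBall y δ := by
          ext z
          simp [Real.dist_eq, abs_sub_comm]
        rw [h2, hdens]
        refine (withDensity_le_mul_volume hM measurableSet_closedBall).trans ?_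
        rw [Real.volume_closedBall, ← ENNReal.ofReal_mul hM0]
        exact ENNReal.ofReal_le_ofReal (by linarith)
    _ = ENNReal.ofReal (2 * M * δ) := by simp

theorem sq_stdDev_le {n : ℕ} (hn : 0 < n) (x : Fin n → ℝ) :
    stdDev x ^ 2 ≤ (∑ p, x p ^ 2) / n := by
  rw [sq_stdDev]
  gcongr ?_ / _
  have h1 := sum_sub_mean hn x
  have h2 : ∑ p, x p ^ 2 =
      ∑ p, ((x p - mean x) ^ 2 + 2 * mean x * (x p - mean x) + mean x ^ 2) :=
    Finset.sum_congr rfl fun p _ => by ring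
  rw [h2, Finset.sum_add_distrib, Finset.sum_add_distrib, ← Finset.mul_sum, h1]
  have : 0 ≤ ∑ _p : Fin n, mean x ^ 2 := Finset.sum_nonneg fun _ _ => sq_nonneg _
  linarith

/-- The variance of the data is at most the average of the squares, whose expectation is `E(X_0 ^
2)` for every `n`; Markov's inequality applies. -/
theorem measure_le_sq_stdDev {Ω : Type*} [MeasurableSpace Ω] {P : Measure Ω}
    [IsProbabilityMeasure P] {X : ℕ → Ω → ℝ} (hident : ∀ i, IdentDistrib (X i) (X 0) P P)
    (hsq : Integrable (fun ω => X 0 ω ^ 2) P) {n : ℕ} (hn : 0 < n) {ε : ℝ} (hε : 0 < ε) :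
    P {ω | ε ≤ stdDev (fun p : Fin n => X p ω) ^ 2} ≤
      ENNReal.ofReal ((∫ ω, X 0 ω ^ 2 ∂P) / ε) := by
  have hid : ∀ i, IdentDistrib (fun ω => X i ω ^ 2) (fun ω => X 0 ω ^ 2) P P := fun i =>
    (hident i).comp (measurable_id.pow_const 2)
  have hint : ∀ i, Integrable (fun ω => X i ω ^ 2) P := fun i => (hid i).integrable_iff.2 hsq
  have hV : Integrable (fun ω => (∑ p : Fin n, X p ω ^ 2) / n) P :=
    (integrable_finsetSum Finset.univ fun p _ => hint (p : Fin n)).div_const _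
  have hVint : ∫ ω, (∑ p : Fin n, X p ω ^ 2) / n ∂P = ∫ ω, X 0 ω ^ 2 ∂P := by
    have hn' : (n : ℝ) ≠ 0 := by positivity
    rw [integral_div, integral_finsetSum Finset.univ fun p _ => hint (p : Fin n)]
    simp only [fun i => (hid i).integral_eq, Finset.sum_const, Finset.card_univ, Fintype.card_fin,
      nsmul_eq_mul]
    field_simp
  have hmarkov := mul_meas_ge_le_integral_of_nonneg
    (Filter.Eventually.of_forall fun ω => by positivity) hV ε
  rw [hVint] at hmarkov
  rw [← ofReal_measureReal]
  refine ENNReal.ofReal_le_ofReal ?_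
  rw [le_div_iff₀' hε]
  refine le_trans ?_ hmarkov
  gcongr
  · exact measure_ne_top _ _
  · exact sq_stdDev_le hn _

/-- The probability of needing more than `j` iterations decays geometrically. -/
theorem measure_numPoints_ne_one_le {Ω : Type*} [MeasurableSpace Ω] {P : Measure Ω}
    [IsProbabilityMeasure P] {X : ℕ → Ω → ℝ} (hX : ∀ i, Measurable (X i))
    (hindep : iIndepFun X P) (hident : ∀ i, IdentDistrib (X i) (X 0) P P)
    {f : ℝ → ℝ} (hdens : P.map (X 0) = volume.withDensity fun t => ENNReal.ofReal (f t))
    {M : ℝ} (hM0 : 0 ≤ M) (hM : ∀ t, f t ≤ M)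
    (hsq : Integrable (fun ω => X 0 ω ^ 2) P)
    {B : ℕ} (hB : 2 ≤ B) (modified : Bool) {n : ℕ} (hn : Odd n) (j : ℕ) :
    P {ω | ∀ i ≤ j, numPoints modified B (fun p : Fin n => X p ω) i ≠ 1} ≤
      ENNReal.ofReal ((1 + 2 * M + 4 * ∫ ω, X 0 ω ^ 2 ∂P) * n ^ 2 * (3 / 4) ^ j) := by
  have hm : 0 ≤ ∫ ω, X 0 ω ^ 2 ∂P := integral_nonneg fun ω => sq_nonneg _
  set m := ∫ ω, X 0 ω ^ 2 ∂P with hmdef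
  have hn1 : (1 : ℝ) ≤ n := by exact_mod_cast hn.pos
  -- The summand 1 in the constant makes the bound trivial at `j = 0`.
  have hn2 : (1 : ℝ) ≤ (n : ℝ) ^ 2 := one_le_pow₀ hn1
  rcases j with _ | j
  · refine prob_le_one.trans ?_
    rw [← ENNReal.ofReal_one]
    refine ENNReal.ofReal_le_ofReal ?_
    rw [pow_zero, mul_one]
    nlinarith
  -- The rate `r = 3/4` lies strictly between `1/2` and 1: `r < 1` makes close pairs rare, and `2r >
  -- 1` makes the required `σ² ≥ (2r) ^ (2(j + 1)) / 4` rare.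
  have hsub : {ω | ∀ i ≤ j + 1, numPoints modified B (fun p : Fin n => X p ω) i ≠ 1} ⊆
      (⋃ q ∈ (Finset.univ : Finset (Fin n)).offDiag,
        {ω | |X q.1 ω - X q.2 ω| ≤ (3 / 4) ^ (j + 1)}) ∪
      {ω | (9 / 4) ^ (j + 1) / 4 ≤ stdDev (fun p : Fin n => X p ω) ^ 2} := by
    intro ω hω
    obtain ⟨p, q, hpq, hd⟩ := exists_close_of_numPoints_ne_one hn (by omega) modified _ j
      (hω (j + 1) le_rfl)
    rcases le_total ((3 / 4 : ℝ) ^ (j + 1))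
      (2 * stdDev (fun p : Fin n => X p ω) / B ^ (j + 1)) with h | h
    · right
      have hs := stdDev_nonneg (fun p : Fin n => X p ω)
      have hB' : (2 : ℝ) ≤ B := by exact_mod_cast hB
      have h1 : 2 * stdDev (fun p : Fin n => X p ω) / B ^ (j + 1) ≤
          2 * stdDev (fun p : Fin n => X p ω) / 2 ^ (j + 1) := by gcongr
      have h2 := h.trans h1
      rw [le_div_iff₀ (by positivity), ← mul_pow] at h2
      have h3 := pow_le_pow_left₀ (by positivity) h2 2
      rw [← pow_mul, mul_comm (j + 1) 2, pow_mul] at h3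
      norm_num at h3
      simp only [Set.mem_ofPred_eq]
      linarith [mul_pow (2 : ℝ) (stdDev (fun p : Fin n => X p ω)) 2]
    · left
      simp only [Set.mem_iUnion]
      exact ⟨(p, q), by simpa using hpq, hd.trans h⟩
  have hpair : ∀ q ∈ (Finset.univ : Finset (Fin n)).offDiag,
      P {ω | |X q.1 ω - X q.2 ω| ≤ (3 / 4) ^ (j + 1)} ≤
        ENNReal.ofReal (2 * M * (3 / 4) ^ (j + 1)) := by
    intro q hq
    have hne : (q.1 : ℕ) ≠ q.2 := fun h => (Finset.mem_offDiag.1 hq).2.2 (Fin.ext h)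
    exact measure_abs_sub_le (hX _) (hX _) (hindep.indepFun hne)
      (((hident _).map_eq).trans hdens) hM0 hM _
  have hcard : (((Finset.univ : Finset (Fin n)).offDiag.card : ℕ) : ℝ) ≤ (n : ℝ) ^ 2 := by
    rw [Finset.offDiag_card, Finset.card_univ, Fintype.card_fin]
    refine (Nat.cast_le.2 (Nat.sub_le _ _)).trans ?_
    push_cast; rw [sq]
  refine (measure_mono hsub).trans ((measure_union_le _ _).trans ?_)
  have h1 := (measure_biUnion_finset_le (μ := P) (Finset.univ : Finset (Fin n)).offDiag
    fun q => {ω | |X q.1 ω - X q.2 ω| ≤ (3 / 4) ^ (j + 1)}).trans (Finset.sum_le_sum hpair)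
  have h2 := measure_le_sq_stdDev hident hsq hn.pos (ε := (9 / 4) ^ (j + 1) / 4) (by positivity)
  rw [← hmdef] at h2
  rw [Finset.sum_const, nsmul_eq_mul, ← ENNReal.ofReal_natCast,
    ← ENNReal.ofReal_mul (by positivity)] at h1
  refine (add_le_add h1 h2).trans ?_
  rw [← ENNReal.ofReal_add (by positivity) (by positivity)]
  refine ENNReal.ofReal_le_ofReal ?_
  have h3 : m / ((9 / 4) ^ (j + 1) / 4) = 4 * m * (4 / 9) ^ (j + 1) := by
    rw [div_div_eq_mul_div, div_eq_mul_inv, ← inv_pow]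
    norm_num; ring
  have h4 : (4 / 9 : ℝ) ^ (j + 1) ≤ (3 / 4) ^ (j + 1) := 
    pow_le_pow_left₀ (by norm_num) (by norm_num) _
  rw [h3]
  have h5 : 4 * m * (4 / 9) ^ (j + 1) ≤ 4 * m * (n : ℝ) ^ 2 * (3 / 4) ^ (j + 1) := by
    calc 4 * m * (4 / 9) ^ (j + 1) ≤ 4 * m * 1 * (3 / 4) ^ (j + 1) := by
          rw [mul_one]; gcongr
      _ ≤ _ := by gcongr
  have h6 : (((Finset.univ : Finset (Fin n)).offDiag.card : ℕ) : ℝ) * (2 * M * (3 / 4) ^ (j + 1)) ≤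
      (n : ℝ) ^ 2 * (2 * M * (3 / 4) ^ (j + 1)) := by gcongr
  have h7 : 0 ≤ (n : ℝ) ^ 2 * (3 / 4) ^ (j + 1) := by positivity
  linear_combination h5 + h6 + h7

/-! ### Summation -/

/-- The first `J` terms are bounded by 1 and the rest by the geometric series. -/
theorem tsum_le_of_le_one_of_le_geometric {u : ℕ → ℝ≥0∞} {A r : ℝ} (hA : 0 ≤ A) (hr : 0 ≤ r)
    (hr1 : r < 1) (h1 : ∀ j, u j ≤ 1) (h2 : ∀ j, u j ≤ ENNReal.ofReal (A * r ^ j)) (J : ℕ) :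
    ∑' j, u j ≤ ENNReal.ofReal (J + A * r ^ J * (1 - r)⁻¹) := by
  have hr' : 0 ≤ (1 - r)⁻¹ := inv_nonneg.2 (by linarith)
  have hsplit : ∑' j, u j = ∑ j ∈ Finset.range J, u j + ∑' j, u (j + J) :=
    (Summable.sum_add_tsum_nat_add' (f := u) (k := J) ENNReal.summable).symm
  rw [hsplit, ENNReal.ofReal_add (by positivity) (by positivity)]
  refine add_le_add ?_ ?_
  · refine (Finset.sum_le_sum fun j _ => h1 j).trans ?_
    simp
  · refine (ENNReal.tsum_le_tsum fun j => h2 (j + J)).trans ?_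
    have h3 : ∀ j, A * r ^ (j + J) = A * r ^ J * r ^ j := fun j => by ring
    simp only [h3]
    rw [← ENNReal.ofReal_tsum_of_nonneg (fun j => by positivity)
      ((summable_geometric_of_lt_one hr hr1).mul_left _), tsum_mul_left,
      tsum_geometric_of_lt_one hr hr1]

/-- The number of steps after which `n ^ 2 * (3 / 4) ^ j` drops below one is logarithmic. -/
theorem exists_nat_sq_mul_pow_le_one {n : ℕ} (hn : 1 ≤ n) :
    ∃ J : ℕ, (J : ℝ) ≤ 2 / Real.log (4 / 3) * Real.log n + 1 ∧ (n : ℝ) ^ 2 * (3 / 4) ^ J ≤ 1 := by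
  have hl : 0 < Real.log (4 / 3) := Real.log_pos (by norm_num)
  have hn1 : (1 : ℝ) ≤ n := by exact_mod_cast hn
  have hln : 0 ≤ Real.log n := Real.log_nonneg hn1
  refine ⟨⌈2 / Real.log (4 / 3) * Real.log n⌉₊, (Nat.ceil_lt_add_one (by positivity)).le, ?_⟩
  have h1 := Nat.le_ceil (2 / Real.log (4 / 3) * Real.log n)
  set J := ⌈2 / Real.log (4 / 3) * Real.log n⌉₊
  have h2 : (n : ℝ) ^ 2 ≤ (4 / 3) ^ J := by
    rw [← Real.log_le_log_iff (by positivity) (by positivity), Real.log_pow, Real.log_pow]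
    rw [div_mul_eq_mul_div, div_le_iff₀ hl] at h1
    exact_mod_cast h1
  calc (n : ℝ) ^ 2 * (3 / 4) ^ J ≤ (4 / 3) ^ J * (3 / 4) ^ J := by gcongr
    _ = 1 := by rw [← mul_pow]; norm_num

theorem numIterations_one (modified : Bool) (B : ℕ) (x : Fin 1 → ℝ) :
    numIterations modified B x = 0 :=
  nonpos_iff_eq_zero.1 (iInf₂_le 0 (by simp [numPoints, stateAt, init]))

end Binmedian

/-! ### The bound on the expectation. -/

theorem mainTheorem3 {Ω : Type*} [MeasurableSpace Ω] (P : Measure Ω) [IsProbabilityMeasure P]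
    (X : ℕ → Ω → ℝ) (hX : ∀ i, Measurable (X i))
    (hindep : iIndepFun X P) (hident : ∀ i, IdentDistrib (X i) (X 0) P P)
    (f : ℝ → ℝ) (hf : Measurable f) (hf0 : ∀ t, 0 ≤ f t)
    (hdens : P.map (X 0) = volume.withDensity fun t => ENNReal.ofReal (f t))
    (M : ℝ) (hM : ∀ t, f t ≤ M)
    (hmom : Integrable (fun ω => X 0 ω ^ 4) P)
    (B : ℕ) (hB : 2 ≤ B) (modified : Bool) :
    (∀ n : ℕ, Odd n → Measurable fun ω =>
      ((Binmedian.numIterations modified B fun p : Fin n => X p ω : ℕ∞) : ℝ≥0∞)) ∧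
    ∃ K : ℝ, ∀ n : ℕ, Odd n →
      ∫⁻ ω, ((Binmedian.numIterations modified B fun p : Fin n => X p ω : ℕ∞) : ℝ≥0∞) ∂P
        ≤ ENNReal.ofReal (K * Real.log n) := by
  have hdata : ∀ n : ℕ, Measurable fun ω => fun p : Fin n => X p ω := fun n =>
    measurable_pi_lambda _ fun p => hX p
  refine ⟨fun n _ => (Binmedian.measurable_numIterations modified B).comp (hdata n), ?_⟩
  have hM0 : 0 ≤ M := (hf0 0).trans (hM 0)
  have hsq : Integrable (fun ω => X 0 ω ^ 2) P := by
    refine ((integrable_const (1 : ℝ)).add hmom).mono' ((hX 0).pow_const 2).aestronglyMeasurable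
      (Filter.Eventually.of_forall fun ω => ?_)
    rw [Real.norm_of_nonneg (sq_nonneg _), Pi.add_apply]
    nlinarith [sq_nonneg (X 0 ω ^ 2 - 1), sq_nonneg (X 0 ω)]
  have hm : 0 ≤ ∫ ω, X 0 ω ^ 2 ∂P := integral_nonneg fun ω => sq_nonneg _
  set C := 1 + 2 * M + 4 * ∫ ω, X 0 ω ^ 2 ∂P with hC
  have hC0 : 0 ≤ C := by positivity
  -- The cutoff contributes at most `2 / log (4/3) * log n + 1` and the tail `C * (1 - 3/4)⁻¹ = 4C`.
  -- Since `log n ≥ 1` for odd `n ≥ 3`, the constants are absorbed; for `n = 1` both sides vanish.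
  refine ⟨2 / Real.log (4 / 3) + 1 + 4 * C, fun n hn => ?_⟩
  rcases Nat.eq_or_lt_of_le hn.pos with h1 | h1
  · obtain rfl : 1 = n := h1
    simp [Binmedian.numIterations_one]
  have h3 : 3 ≤ n := by obtain ⟨k, rfl⟩ := hn; omega
  have hlog : 1 ≤ Real.log n := by
    rw [Real.le_log_iff_exp_le (by positivity)]
    have : (3 : ℝ) ≤ n := by exact_mod_cast h3
    linarith [Real.exp_one_lt_d9]
  have hset : ∀ j, MeasurableSet
      {ω | ∀ i ≤ j, Binmedian.numPoints modified B (fun p : Fin n => X p ω) i ≠ 1} := fun j =>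
    hdata n (Binmedian.measurableSet_numPoints_ne_one modified B j)
  have hsum : ∫⁻ ω, ((Binmedian.numIterations modified B fun p : Fin n => X p ω : ℕ∞) : ℝ≥0∞) ∂P =
      ∑' j, P {ω | ∀ i ≤ j, Binmedian.numPoints modified B (fun p : Fin n => X p ω) i ≠ 1} := by
    simp only [Binmedian.numIterations_eq_tsum]
    refine (lintegral_tsum fun j => ((measurable_one.indicator
      (Binmedian.measurableSet_numPoints_ne_one modified B j)).comp (hdata n)).aemeasurable).trans ?_
    exact tsum_congr fun j => lintegral_indicator_one (hset j)
  obtain ⟨J, hJ, hJ'⟩ := Binmedian.exists_nat_sq_mul_pow_le_one hn.pos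
  rw [hsum]
  refine (Binmedian.tsum_le_of_le_one_of_le_geometric (A := C * n ^ 2) (r := 3 / 4) (by positivity)
    (by norm_num) (by norm_num) (fun _ => prob_le_one)
    (fun j => Binmedian.measure_numPoints_ne_one_le hX hindep hident hdens hM0 hM hsq hB modified
      hn j) J).trans (ENNReal.ofReal_le_ofReal ?_)
  have h4 : C * (n ^ 2 * (3 / 4) ^ J) ≤ C * 1 := by gcongr
  norm_num
  nlinarith
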